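/- Let $\mathcal X,\mathcal Y,\mathcal Z$ be finite alphabets, $P_{XY}$ a pmf on $\mathcal X\times\mathcal Y$, $d\colon\mathcal X\times\mathcal Z\to[0,\infty)$ a per-symbol distortion function and $D>0$. Let $(X_i,Y_i)_{i\ge1}$ be i.i.d. with pmf $P_{XY}$. For $\epsilon\in[0,1)$, a rate $R>0$ is called $\epsilon$-achievable if there are sequences (in the blocklength $n$) of encoders $\phi^{(n)}\colon\mathcal X^n\to\{0,1\}^{\lceil nR\rceil}$ and decoders $g^{(n)}\colon\{0,1\}^{\lceil nR\rceil}\times\mathcal Y^n\to\mathcal Z^n$ such that, with $Z^n=g^{(n)}(\phi^{(n)}(X^n),Y^n)$, $$\varlimsup_{n\to\infty}\Pr\Big[\frac1n\sum_{i=1}^n d(X_i,Z_i)>D\Big]\le\epsilon .$$ Define $$R_{\min}:=\min_{\substack{P_{S|X},\,P_{Z|SY}:\\ \mathbb E[d(X,Z)]\le D}} I(X;S|Y),$$ where $S$ ranges over all random variables with a finite alphabet, the expectation and the conditional mutual information (in bits) are computed for the pmf $P_{SXYZ}=P_{S|X}P_{XY}P_{Z|SY}$, and $R_{\min}:=+\infty$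 if no choice of $P_{S|X},P_{Z|SY}$ satisfies the constraint. Then the minimum is attained whenever the constraint can be satisfied, and for every $\epsilon\in[0,1)$ no rate $R$ with $0<R<R_{\min}$ is $\epsilon$-achievable. -/

import Mathlib

namespace WynerZiv

/-- The pmf of the random variable `f` on the finite probability space with pmf `p`. -/
noncomputable def law {Ω A : Type*} [Fintype Ω] (p : Ω → ℝ) (f : Ω → A) (a : A) : ℝ :=
  open Classical in ∑ ω, if f ω = a then p ω else 0

/-- Shannon entropy `H(f)`, in bits, of the random variable `f` under the pmf `p`. -/
noncomputable def entropy {Ω A : Type*} [Fintype Ω] [Fintype A] (p : Ω → ℝ) (f : Ω → A) : ℝ :=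
  (∑ a, Real.negMulLog (law p f a)) / Real.log 2

/-- Conditional entropy `H(f | h) = H(f, h) - H(h)`, in bits. -/
noncomputable def condEntropy {Ω A C : Type*} [Fintype Ω] [Fintype A] [Fintype C]
    (p : Ω → ℝ) (f : Ω → A) (h : Ω → C) : ℝ :=
  entropy p (fun ω => (f ω, h ω)) - entropy p h

/-- Conditional mutual information `I(f; g | h) = H(f | h) - H(f | g, h)`, in bits. -/
noncomputable def condMutualInfo {Ω A B C : Type*} [Fintype Ω] [Fintype A] [Fintype B] [Fintype C]
    (p : Ω → ℝ) (f : Ω → A) (g : Ω → B) (h : Ω → C) : ℝ :=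
  condEntropy p f h - condEntropy p f (fun ω => (g ω, h ω))

/-- The function `(s, x, y, z) ↦ P_{S|X}(s|x) P_{XY}(x,y) P_{Z|SY}(z|s,y)`, where
`W x s = P_{S|X}(s|x)` and `V s y z = P_{Z|SY}(z|s,y)`. -/
noncomputable def jointPmf {X Y Z S : Type*} (P : X × Y → ℝ) (W : X → S → ℝ)
    (V : S → Y → Z → ℝ) : S × X × Y × Z → ℝ :=
  fun ω => W ω.2.1 ω.1 * P (ω.2.1, ω.2.2.1) * V ω.1 ω.2.2.1 ω.2.2.2

/-- The values `I(X;S|Y)` over all finite alphabets of `S` and all conditional pmfs `P_{S|X}`,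
`P_{Z|SY}` with `E[d(X,Z)] ≤ D`. -/
def feasibleRates {X Y Z : Type*} [Fintype X] [Fintype Y] [Fintype Z]
    (P : X × Y → ℝ) (d : X → Z → ℝ) (D : ℝ) : Set ℝ :=
  {r | ∃ (k : ℕ) (W : X → Fin k → ℝ) (V : Fin k → Y → Z → ℝ),
    (∀ x, W x ∈ stdSimplex ℝ (Fin k)) ∧ (∀ s y, V s y ∈ stdSimplex ℝ Z) ∧
    ∑ ω, jointPmf P W V ω * d ω.2.1 ω.2.2.2 ≤ D ∧
    r = condMutualInfo (jointPmf P W V) (fun ω => ω.2.1) (fun ω => ω.1) (fun ω => ω.2.2.1)}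

/-- `R_min`, the infimum of the feasible rates; it is `⊤` if the distortion constraint cannot
be met. -/
noncomputable def Rmin {X Y Z : Type*} [Fintype X] [Fintype Y] [Fintype Z]
    (P : X × Y → ℝ) (d : X → Z → ℝ) (D : ℝ) : EReal :=
  ⨅ r ∈ feasibleRates P d D, (r : EReal)

/-- `Pr[(1/n) ∑ d(X_i, Z_i) > D]` for `(X^n, Y^n)` i.i.d. with pmf `P` and
`Z^n = g(φ(X^n), Y^n)`. -/
noncomputable def excessProb {X Y Z M : Type*} [Fintype X] [Fintype Y]
    (P : X × Y → ℝ) (d : X → Z → ℝ) (D : ℝ) {n : ℕ}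
    (φ : (Fin n → X) → M) (g : M → (Fin n → Y) → (Fin n → Z)) : ℝ :=
  open Classical in
  ∑ ω : Fin n → X × Y,
    if D < (1 / (n : ℝ)) * ∑ i, d (ω i).1 (g (φ fun j => (ω j).1) (fun j => (ω j).2) i)
    then ∏ i, P (ω i) else 0

/-- `R` is `ε`-achievable: some sequence of codes with messages of `⌈nR⌉` bits has asymptotic
excess-distortion probability at most `ε`. -/
def Achievable {X Y Z : Type*} [Fintype X] [Fintype Y]
    (P : X × Y → ℝ) (d : X → Z → ℝ) (D ε R : ℝ) : Prop :=
  ∃ (φ : ∀ n : ℕ, (Fin n → X) → (Fin ⌈(n : ℝ) * R⌉₊ → Bool))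
    (g : ∀ n : ℕ, (Fin ⌈(n : ℝ) * R⌉₊ → Bool) → (Fin n → Y) → (Fin n → Z)),
    Filter.limsup (fun n => excessProb P d D (φ n) (g n)) Filter.atTop ≤ ε

end WynerZiv

/-!
Conditioning the i.i.d. source on the event `G` that a code meets the distortion constraint changes
its law by relative entropy `-log Pr(G)` only. For `ε < 1` this stays bounded in the blocklength
`n`, so the conditioned source is within relative entropy `O(1)` of the i.i.d. one, and it meets the
distortion constraint surely.

Under the conditioned law, single-letterize with the auxiliary variable
`S = (T, M, (X_i)_{i < T}, (Y_i)_{i > T})`, where `M` is the message and `T` a uniform time. By the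
Csiszár sum identity, `I(X_T; S | Y_T)` is at most the rate of the code up to `O(1/n)`, and the
Markov chains `S - X - Y` and `X - (S, Y) - Z` hold up to conditional mutual information `O(1/n)`.
Since Carathéodory's theorem bounds the alphabet of `S` independently of `n`, a compactness argument
then produces an exactly feasible joint pmf whose rate is at most that of the codes. Applied to
exactly feasible pmfs, the same compactness yields the minimum.
-/

namespace WynerZiv

open Finset Filter Topology InformationTheory

section RelEntropy

variable {ι : Type*} [Fintype ι]

/-- The relative entropy `D(a ‖ b)`, in bits, of two nonnegative vectors. Writing it with
`klFun t = t log t + 1 - t` makes every term nonnegative and continuous in `a`. Since `a / 0 = 0`,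
it is meaningful only if `a` vanishes wherever `b` does. -/
noncomputable def relEntropy (a b : ι → ℝ) : ℝ :=
  (∑ i, b i * klFun (a i / b i)) / Real.log 2

theorem relEntropy_nonneg {a b : ι → ℝ} (ha : ∀ i, 0 ≤ a i) (hb : ∀ i, 0 ≤ b i) :
    0 ≤ relEntropy a b :=
  div_nonneg (sum_nonneg fun i _ => mul_nonneg (hb i) (klFun_nonneg (div_nonneg (ha i) (hb i))))
    (Real.log_nonneg one_le_two)

theorem relEntropy_eq_zero_iff {a b : ι → ℝ} (ha : ∀ i, 0 ≤ a i) (hb : ∀ i, 0 ≤ b i)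
    (hab : ∀ i, b i = 0 → a i = 0) : relEntropy a b = 0 ↔ a = b := by
  have hquot (i : ι) : 0 ≤ a i / b i := div_nonneg (ha i) (hb i)
  rw [relEntropy, div_eq_zero_iff, or_iff_left (Real.log_pos one_lt_two).ne',
    sum_eq_zero_iff_of_nonneg fun i _ => mul_nonneg (hb i) (klFun_nonneg (hquot i)), funext_iff]
  refine ⟨fun h i => ?_, fun h i _ => ?_⟩
  · rcases mul_eq_zero.1 (h i (mem_univ i)) with hi | hi
    · rw [hi, hab i hi]
    · exact eq_of_div_eq_one ((klFun_eq_zero_iff (hquot i)).1 hi)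
  · rcases eq_or_ne (b i) 0 with hi | hi
    · simp [hi]
    · simp [h i, hi, klFun_one]

theorem relEntropy_eq_sum_mul_logb_sub {a b : ι → ℝ} (hab : ∀ i, b i = 0 → a i = 0)
    (hsum : ∑ i, a i = ∑ i, b i) :
    relEntropy a b = ∑ i, a i * (Real.logb 2 (a i) - Real.logb 2 (b i)) := by
  have hterm (i : ι) : b i * klFun (a i / b i)
      = a i * (Real.logb 2 (a i) - Real.logb 2 (b i)) * Real.log 2 + (b i - a i) := by
    rcases eq_or_ne (a i) 0 with ha | ha
    · simp [ha, klFun_zero]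
    · have hb : b i ≠ 0 := mt (hab i) ha
      simp only [klFun_apply, Real.log_div ha hb, Real.logb]
      field_simp
      ring
  simp only [relEntropy, hterm, sum_add_distrib, sum_sub_distrib, hsum, sub_self, add_zero,
    ← sum_mul]
  exact mul_div_cancel_right₀ _ (Real.log_pos one_lt_two).ne'

theorem continuous_relEntropy_left (b : ι → ℝ) : Continuous fun a : ι → ℝ => relEntropy a b :=
  (continuous_finsetSum _ fun i _ => continuous_const.mul
    (continuous_klFun.comp ((continuous_apply i).div_const _))).div_const _

end RelEntropy

section Law

variable {Ω A B C : Type*} [Fintype Ω] {p : Ω → ℝ}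

theorem law_eq_law (p : Ω → ℝ) {f : Ω → A} {g : Ω → B} {a : A} {b : B}
    (h : ∀ ω, f ω = a ↔ g ω = b) : law p f a = law p g b := by
  classical
  exact sum_congr rfl fun ω _ => if_congr (h ω) rfl rfl

theorem law_le_law (hp : ∀ ω, 0 ≤ p ω) {f : Ω → A} {g : Ω → B} {a : A} {b : B}
    (h : ∀ ω, f ω = a → g ω = b) : law p f a ≤ law p g b := by
  classical
  refine sum_le_sum fun ω _ => ?_
  split_ifs with ha hb hb
  exacts [le_rfl, absurd (h ω ha) hb, hp ω, le_rfl]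

theorem law_nonneg (hp : ∀ ω, 0 ≤ p ω) (f : Ω → A) (a : A) : 0 ≤ law p f a := by
  classical
  exact sum_nonneg fun ω _ => ite_nonneg (hp ω) le_rfl

theorem law_eq_zero_of_imp (hp : ∀ ω, 0 ≤ p ω) {f : Ω → A} {g : Ω → B} {a : A} {b : B}
    (h : ∀ ω, f ω = a → g ω = b) (hb : law p g b = 0) : law p f a = 0 :=
  le_antisymm ((law_le_law hp h).trans hb.le) (law_nonneg hp f a)

theorem law_id (p : Ω → ℝ) : law p (fun ω => ω) = p := by
  classical
  funext a
  simp [law]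

theorem le_law (hp : ∀ ω, 0 ≤ p ω) (f : Ω → A) (ω : Ω) : p ω ≤ law p f (f ω) := by
  conv_lhs => rw [← law_id p]
  exact law_le_law hp fun ω' h => congrArg f h

theorem law_apply_ne_zero (hp : ∀ ω, 0 ≤ p ω) {ω : Ω} (hω : p ω ≠ 0) (f : Ω → A) :
    law p f (f ω) ≠ 0 :=
  (((hp ω).lt_of_ne' hω).trans_le (le_law hp f ω)).ne'

theorem sum_law_mul [Fintype A] (p : Ω → ℝ) (f : Ω → A) (F : A → ℝ) :
    ∑ a, law p f a * F a = ∑ ω, p ω * F (f ω) := by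
  classical
  simp only [law, sum_mul, ite_mul, zero_mul]
  rw [sum_comm]
  simp

theorem sum_law [Fintype A] (p : Ω → ℝ) (f : Ω → A) : ∑ a, law p f a = ∑ ω, p ω := by
  simpa using sum_law_mul p f fun _ => 1

theorem law_mem_stdSimplex [Fintype A] (hp : p ∈ stdSimplex ℝ Ω) (f : Ω → A) :
    law p f ∈ stdSimplex ℝ A :=
  ⟨law_nonneg hp.1 f, (sum_law p f).trans hp.2⟩

theorem law_law [Fintype A] (p : Ω → ℝ) (f : Ω → A) (g : A → B) :
    law (law p f) g = law p fun ω => g (f ω) := by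
  classical
  funext b
  simpa [law] using sum_law_mul p f fun a => if g a = b then (1 : ℝ) else 0

theorem sum_law_prod_left [Fintype A] (p : Ω → ℝ) (f : Ω → A) (g : Ω → B) (b : B) :
    ∑ a, law p (fun ω => (f ω, g ω)) (a, b) = law p g b := by
  classical
  simp only [law, Prod.mk.injEq]
  rw [sum_comm]
  refine sum_congr rfl fun ω _ => ?_
  by_cases h : g ω = b <;> simp [h]

theorem law_smul (c : ℝ) (p : Ω → ℝ) (f : Ω → A) : law (c • p) f = c • law p f := by
  classical
  funext a
  simp [law, mul_sum, mul_ite]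

theorem continuous_law (f : Ω → A) : Continuous fun p : Ω → ℝ => law p f := by
  classical
  refine continuous_pi fun a => continuous_finsetSum _ fun ω _ => ?_
  split_ifs <;> fun_prop

theorem nonempty_of_mem_stdSimplex (hp : p ∈ stdSimplex ℝ Ω) : Nonempty Ω := by
  by_contra h
  have := not_nonempty_iff.1 h
  simp [stdSimplex_of_isEmpty_index] at hp

theorem exists_law_prod_eq_mul [Fintype B] (hp : p ∈ stdSimplex ℝ Ω) (g : Ω → B) (h : Ω → C) :
    ∃ K : C → B → ℝ, (∀ c, K c ∈ stdSimplex ℝ B) ∧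
      ∀ b c, law p (fun ω => (g ω, h ω)) (b, c) = law p h c * K c b := by
  classical
  obtain ⟨ω₀⟩ := nonempty_of_mem_stdSimplex hp
  refine ⟨fun c => if law p h c = 0 then Pi.single (g ω₀) 1
    else fun b => law p (fun ω => (g ω, h ω)) (b, c) / law p h c, fun c => ?_, fun b c => ?_⟩
  · dsimp only
    split_ifs with hc
    · exact single_mem_stdSimplex ℝ _
    · refine ⟨fun b => div_nonneg (law_nonneg hp.1 _ _) (law_nonneg hp.1 _ _), ?_⟩
      rw [← sum_div, sum_law_prod_left, div_self hc]
  · dsimp only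
    split_ifs with hc
    · rw [hc, zero_mul]
      exact law_eq_zero_of_imp hp.1 (fun ω hω => congrArg Prod.snd hω) hc
    · rw [mul_div_cancel₀ _ hc]

/-- The law that `(f, g, h)` would have if `f` and `g` were conditionally independent given `h`. -/
noncomputable def condProductLaw (p : Ω → ℝ) (f : Ω → A) (g : Ω → B) (h : Ω → C) :
    A × B × C → ℝ :=
  fun (a, b, c) =>
    law p (fun ω => (f ω, h ω)) (a, c) * law p (fun ω => (g ω, h ω)) (b, c) / law p h c

theorem condProductLaw_nonneg (hp : ∀ ω, 0 ≤ p ω) (f : Ω → A) (g : Ω → B) (h : Ω → C)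
    (t : A × B × C) : 0 ≤ condProductLaw p f g h t :=
  div_nonneg (mul_nonneg (law_nonneg hp _ _) (law_nonneg hp _ _)) (law_nonneg hp _ _)

theorem law_eq_zero_of_condProductLaw_eq_zero (hp : ∀ ω, 0 ≤ p ω) {f : Ω → A} {g : Ω → B}
    {h : Ω → C} {t : A × B × C} (ht : condProductLaw p f g h t = 0) :
    law p (fun ω => (f ω, g ω, h ω)) t = 0 := by
  obtain ⟨a, b, c⟩ := t
  rw [condProductLaw, div_eq_zero_iff, mul_eq_zero] at ht
  rcases ht with (ht | ht) | ht <;> refine law_eq_zero_of_imp hp (fun ω hω => ?_) ht <;>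
    simp_all

end Law

section Entropy

variable {Ω A B C : Type*} [Fintype Ω] [Fintype A] [Fintype B] [Fintype C] {p : Ω → ℝ}

theorem entropy_eq_neg_sum_mul_logb (p : Ω → ℝ) (f : Ω → A) :
    entropy p f = -∑ ω, p ω * Real.logb 2 (law p f (f ω)) := by
  rw [← sum_law_mul p f fun a => Real.logb 2 (law p f a), entropy, ← sum_neg_distrib, sum_div]
  exact sum_congr rfl fun a _ => by rw [Real.negMulLog, Real.logb]; ring

theorem entropy_congr (p : Ω → ℝ) {f : Ω → A} {g : Ω → B}
    (h : ∀ ω ω', f ω = f ω' ↔ g ω = g ω') : entropy p f = entropy p g := by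
  simp only [entropy_eq_neg_sum_mul_logb, law_eq_law p fun ω => h ω _]

theorem entropy_law (p : Ω → ℝ) (f : Ω → A) (g : A → B) :
    entropy (law p f) g = entropy p fun ω => g (f ω) := by
  simp only [entropy, law_law]

theorem condEntropy_law (p : Ω → ℝ) (f : Ω → A) (g : A → B) (h : A → C) :
    condEntropy (law p f) g h = condEntropy p (fun ω => g (f ω)) fun ω => h (f ω) := by
  simp only [condEntropy, entropy_law]

theorem condEntropy_congr {A' C' : Type*} [Fintype A'] [Fintype C'] (p : Ω → ℝ) {f : Ω → A}
    {f' : Ω → A'} {h : Ω → C} {h' : Ω → C'} (hf : ∀ ω ω', f ω = f ω' ↔ f' ω = f' ω')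
    (hh : ∀ ω ω', h ω = h ω' ↔ h' ω = h' ω') : condEntropy p f h = condEntropy p f' h' := by
  rw [condEntropy, condEntropy, entropy_congr p hh,
    entropy_congr p (g := fun ω => (f' ω, h' ω)) fun ω ω' => by simp only [Prod.mk.injEq, hf, hh]]

theorem condEntropy_const (hp : ∑ ω, p ω = 1) (f : Ω → A) (c : C) :
    condEntropy p f (fun _ => c) = entropy p f := by
  rw [condEntropy, entropy_congr p (f := fun ω => (f ω, c)) (g := f) (by simp), sub_eq_self,
    entropy_eq_neg_sum_mul_logb]
  simp [law, hp]

theorem entropy_smul (c : ℝ) (p : Ω → ℝ) (f : Ω → A) :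
    entropy (c • p) f = c * entropy p f + Real.negMulLog c * (∑ ω, p ω) / Real.log 2 := by
  simp only [entropy, law_smul, Pi.smul_apply, smul_eq_mul, Real.negMulLog_mul, sum_add_distrib,
    ← sum_mul, ← mul_sum, sum_law]
  ring

theorem condEntropy_smul (c : ℝ) (p : Ω → ℝ) (f : Ω → A) (h : Ω → C) :
    condEntropy (c • p) f h = c * condEntropy p f h := by
  simp only [condEntropy, entropy_smul]
  ring

theorem continuous_entropy (f : Ω → A) : Continuous fun p : Ω → ℝ => entropy p f :=
  (continuous_finsetSum _ fun a _ => Real.continuous_negMulLog.comp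
    ((continuous_apply a).comp (continuous_law f))).div_const _

theorem continuous_condMutualInfo (f : Ω → A) (g : Ω → B) (h : Ω → C) :
    Continuous fun p : Ω → ℝ => condMutualInfo p f g h :=
  ((continuous_entropy _).sub (continuous_entropy _)).sub
    ((continuous_entropy _).sub (continuous_entropy _))

theorem sum_condProductLaw (p : Ω → ℝ) (f : Ω → A) (g : Ω → B) (h : Ω → C) :
    ∑ t, condProductLaw p f g h t = ∑ ω, p ω := by
  rw [← sum_law p h]
  simp only [condProductLaw, Fintype.sum_prod_type_right, ← sum_div, ← mul_sum, ← sum_mul,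
    sum_law_prod_left, mul_self_div_self]

theorem condMutualInfo_eq_relEntropy (hp : ∀ ω, 0 ≤ p ω) (f : Ω → A) (g : Ω → B) (h : Ω → C) :
    condMutualInfo p f g h
      = relEntropy (law p fun ω => (f ω, g ω, h ω)) (condProductLaw p f g h) := by
  have hlogb (ω : Ω) : p ω * Real.logb 2 (condProductLaw p f g h (f ω, g ω, h ω))
      = p ω * (Real.logb 2 (law p (fun ω => (f ω, h ω)) (f ω, h ω))
        + Real.logb 2 (law p (fun ω => (g ω, h ω)) (g ω, h ω)) - Real.logb 2 (law p h (h ω))) := by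
    rcases eq_or_ne (p ω) 0 with hω | hω
    · simp [hω]
    · have hfh := law_apply_ne_zero hp hω fun ω => (f ω, h ω)
      have hgh := law_apply_ne_zero hp hω fun ω => (g ω, h ω)
      rw [condProductLaw, Real.logb_div (mul_ne_zero hfh hgh) (law_apply_ne_zero hp hω h),
        Real.logb_mul hfh hgh]
  rw [relEntropy_eq_sum_mul_logb_sub (fun t => law_eq_zero_of_condProductLaw_eq_zero hp)
    (by rw [sum_law, sum_condProductLaw]), sum_law_mul p (fun ω => (f ω, g ω, h ω)) fun t =>
      Real.logb 2 (law p (fun ω => (f ω, g ω, h ω)) t) - Real.logb 2 (condProductLaw p f g h t)]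
  simp only [condMutualInfo, condEntropy, entropy_eq_neg_sum_mul_logb, mul_sub, hlogb, mul_add,
    sum_add_distrib, sum_sub_distrib]
  ring

theorem condMutualInfo_nonneg (hp : ∀ ω, 0 ≤ p ω) (f : Ω → A) (g : Ω → B) (h : Ω → C) :
    0 ≤ condMutualInfo p f g h := by
  rw [condMutualInfo_eq_relEntropy hp]
  exact relEntropy_nonneg (law_nonneg hp _) (condProductLaw_nonneg hp f g h)

theorem condMutualInfo_eq_zero_iff (hp : p ∈ stdSimplex ℝ Ω) (f : Ω → A) (g : Ω → B)
    (h : Ω → C) : condMutualInfo p f g h = 0 ↔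
      ∃ K : C → B → ℝ, (∀ c, K c ∈ stdSimplex ℝ B) ∧ ∀ a b c,
        law p (fun ω => (f ω, g ω, h ω)) (a, b, c)
          = law p (fun ω => (f ω, h ω)) (a, c) * K c b := by
  have hzero {a : A} {c : C} (hc : law p h c = 0) : law p (fun ω => (f ω, h ω)) (a, c) = 0 :=
    law_eq_zero_of_imp hp.1 (fun ω hω => congrArg Prod.snd hω) hc
  have hprod {K : C → B → ℝ} {a : A} {b : B} {c : C}
      (hK : law p (fun ω => (g ω, h ω)) (b, c) = law p h c * K c b) :
      condProductLaw p f g h (a, b, c) = law p (fun ω => (f ω, h ω)) (a, c) * K c b := by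
    rcases eq_or_ne (law p h c) 0 with hc | hc
    · simp [condProductLaw, hc, hzero]
    · rw [condProductLaw, hK]
      field_simp
  rw [condMutualInfo_eq_relEntropy hp.1, relEntropy_eq_zero_iff (law_nonneg hp.1 _)
    (condProductLaw_nonneg hp.1 f g h) fun t => law_eq_zero_of_condProductLaw_eq_zero hp.1]
  constructor
  · intro heq
    obtain ⟨K, hK, hgh⟩ := exists_law_prod_eq_mul hp g h
    exact ⟨K, hK, fun a b c => by rw [heq, hprod (hgh b c)]⟩
  · rintro ⟨K, -, hfgh⟩
    ext ⟨a, b, c⟩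
    rw [hfgh, hprod]
    rw [← sum_law_prod_left p f (fun ω => (g ω, h ω)), ← sum_law_prod_left p f h, sum_mul]
    exact sum_congr rfl fun a _ => hfgh a b c

theorem condEntropy_anti (hp : ∀ ω, 0 ≤ p ω) (f : Ω → A) {g : Ω → B} {h : Ω → C}
    (hgh : h.FactorsThrough g) : condEntropy p f g ≤ condEntropy p f h := by
  have hI := condMutualInfo_nonneg hp f g h
  rwa [condMutualInfo, condEntropy_congr p (f' := f) (h := fun ω => (g ω, h ω)) (h' := g)
    (fun _ _ => Iff.rfl) fun ω ω' => by simpa using @hgh ω ω', sub_nonneg] at hI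

theorem entropy_prod_le (hp : p ∈ stdSimplex ℝ Ω) (f : Ω → A) (g : Ω → B) :
    entropy p (fun ω => (f ω, g ω)) ≤ entropy p f + entropy p g := by
  have h := condEntropy_anti hp.1 f (g := g) (h := fun _ => ()) fun _ _ _ => rfl
  rwa [condEntropy_const hp.2, condEntropy, sub_le_iff_le_add] at h

theorem entropy_pi_le_sum {ι : Type*} [Fintype ι] [DecidableEq ι] (hp : p ∈ stdSimplex ℝ Ω)
    (f : Ω → ι → A) : entropy p f ≤ ∑ i, entropy p fun ω => f ω i := by
  set q : (ι → A) → ℝ := fun a => ∏ i, law p (fun ω => f ω i) (a i)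
  have hlogb (ω : Ω) :
      p ω * Real.logb 2 (q (f ω)) = ∑ i, p ω * Real.logb 2 (law p (fun ω => f ω i) (f ω i)) := by
    rcases eq_or_ne (p ω) 0 with hω | hω
    · simp [hω]
    · rw [Real.logb_prod _ _ fun i _ => law_apply_ne_zero hp.1 hω fun ω => f ω i, mul_sum]
  have hq (a : ι → A) (ha : q a = 0) : law p f a = 0 := by
    obtain ⟨i, -, hi⟩ := prod_eq_zero_iff.1 ha
    exact law_eq_zero_of_imp hp.1 (fun ω hω => congrFun hω i) hi
  have hsum : ∑ a, q a = 1 := by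
    simp only [q, ← Fintype.prod_sum fun i => law p fun ω => f ω i, sum_law, hp.2, prod_const_one]
  have hdiv := relEntropy_nonneg (b := q) (law_nonneg hp.1 f)
    fun a => prod_nonneg fun i _ => law_nonneg hp.1 (fun ω => f ω i) (a i)
  rw [relEntropy_eq_sum_mul_logb_sub hq (by rw [sum_law, hp.2, hsum]), sum_law_mul p f fun a =>
    Real.logb 2 (law p f a) - Real.logb 2 (q a)] at hdiv
  simp only [mul_sub, sum_sub_distrib, hlogb] at hdiv
  rw [sum_comm] at hdiv
  simp only [entropy_eq_neg_sum_mul_logb, sum_neg_distrib]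
  linarith

theorem entropy_le_logb_card (hp : p ∈ stdSimplex ℝ Ω) (f : Ω → A) :
    entropy p f ≤ Real.logb 2 (Fintype.card A) := by
  have : Nonempty A := nonempty_of_mem_stdSimplex (law_mem_stdSimplex hp f)
  have hdiv := relEntropy_nonneg (b := fun _ => (Fintype.card A : ℝ)⁻¹) (law_nonneg hp.1 f)
    fun _ => by positivity
  rw [relEntropy_eq_sum_mul_logb_sub (fun _ h => absurd h (by positivity))
    (by rw [sum_law, hp.2]; simp), sum_law_mul p f fun a =>
      Real.logb 2 (law p f a) - Real.logb 2 (Fintype.card A : ℝ)⁻¹] at hdiv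
  simp only [mul_sub, sum_sub_distrib, ← sum_mul, hp.2, one_mul, Real.logb_inv] at hdiv
  rw [entropy_eq_neg_sum_mul_logb]
  linarith

end Entropy

section Slices

variable {S Ω A C : Type*} [Fintype S] [Fintype Ω] [Fintype A] [Fintype C]

theorem entropy_prod_eq_sum (Q : S × Ω → ℝ) (f : S → Ω → A) :
    entropy Q (fun v => (v.1, f v.1 v.2)) = ∑ s, entropy (fun ω => Q (s, ω)) (f s) := by
  classical
  have hlaw (s : S) (a : A) :
      law Q (fun v => (v.1, f v.1 v.2)) (s, a) = law (fun ω => Q (s, ω)) (f s) a := by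
    simp only [law, Prod.mk.injEq, Fintype.sum_prod_type, ite_and]
    rw [sum_eq_single s (fun t _ hts => by simp [hts]) (by simp)]
    simp
  simp only [entropy, ← sum_div, Fintype.sum_prod_type, hlaw]

theorem condEntropy_prod_eq_sum (Q : S × Ω → ℝ) (f : S → Ω → A) (h : S → Ω → C) :
    condEntropy Q (fun v => f v.1 v.2) (fun v => (v.1, h v.1 v.2))
      = ∑ s, condEntropy (fun ω => Q (s, ω)) (f s) (h s) := by
  simp only [condEntropy, sum_sub_distrib, ← entropy_prod_eq_sum]
  congr 1
  exact entropy_congr Q fun v w => by simp only [Prod.mk.injEq, and_left_comm]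

end Slices

section TimeShare

variable {ι Ω A C : Type*} [Fintype ι] [Fintype Ω] {p : Ω → ℝ}

variable (ι) in
/-- The joint pmf of a time index, uniform on `ι`, and an independent sample from `p`. -/
noncomputable def timeShare (p : Ω → ℝ) : ι × Ω → ℝ :=
  fun v => (Fintype.card ι : ℝ)⁻¹ * p v.2

theorem sum_timeShare_mul (p : Ω → ℝ) (F : ι × Ω → ℝ) :
    ∑ v, timeShare ι p v * F v = (Fintype.card ι : ℝ)⁻¹ * ∑ i, ∑ ω, p ω * F (i, ω) := by
  simp only [timeShare, mul_assoc, ← mul_sum, Fintype.sum_prod_type]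

theorem timeShare_mem_stdSimplex [Nonempty ι] (hp : p ∈ stdSimplex ℝ Ω) :
    timeShare ι p ∈ stdSimplex ℝ (ι × Ω) := by
  refine ⟨fun v => mul_nonneg (by positivity) (hp.1 v.2), ?_⟩
  simpa [hp.2] using sum_timeShare_mul p fun _ : ι × Ω => 1

variable [Fintype A] [Fintype C]

theorem card_mul_condEntropy_timeShare [Nonempty ι] (p : Ω → ℝ) (f : ι → Ω → A) (h : ι → Ω → C) :
    Fintype.card ι * condEntropy (timeShare ι p) (fun v => f v.1 v.2) (fun v => (v.1, h v.1 v.2))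
      = ∑ i, condEntropy p (f i) (h i) := by
  rw [condEntropy_prod_eq_sum, mul_sum]
  refine sum_congr rfl fun i _ => ?_
  have hslice : (fun ω => timeShare ι p (i, ω)) = (Fintype.card ι : ℝ)⁻¹ • p := rfl
  rw [hslice, condEntropy_smul, mul_inv_cancel_left₀ (by positivity)]

theorem entropy_pi_le_card_mul_entropy_timeShare [Nonempty ι] [DecidableEq ι]
    (hp : p ∈ stdSimplex ℝ Ω) (f : Ω → ι → A) :
    entropy p f ≤ Fintype.card ι * entropy (timeShare ι p) fun v => f v.2 v.1 := by
  have hshare := timeShare_mem_stdSimplex (ι := ι) hp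
  calc entropy p f ≤ ∑ i, entropy p fun ω => f ω i := entropy_pi_le_sum hp f
    _ = ∑ i, condEntropy p (fun ω => f ω i) fun _ => () := by
        simp only [condEntropy_const hp.2]
    _ = Fintype.card ι * condEntropy (timeShare ι p) (fun v => f v.2 v.1) fun v => (v.1, ()) :=
        (card_mul_condEntropy_timeShare p (fun i ω => f ω i) fun _ _ => ()).symm
    _ ≤ Fintype.card ι * condEntropy (timeShare ι p) (fun v => f v.2 v.1) fun _ => () := by
        gcongr
        exact condEntropy_anti hshare.1 _ fun _ _ _ => rfl
    _ = Fintype.card ι * entropy (timeShare ι p) fun v => f v.2 v.1 := by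
        rw [condEntropy_const hshare.2]

end TimeShare

section Caratheodory

variable {S A V : Type*} [Fintype S] [Fintype A] [AddCommGroup V] [Module ℝ V]
  {F : (A → ℝ) → V} {Q : S × A → ℝ}

theorem exists_slice_eq_smul (hQ : Q ∈ stdSimplex ℝ (S × A)) :
    ∃ w ∈ stdSimplex ℝ S, ∃ K : S → A → ℝ, (∀ s, K s ∈ stdSimplex ℝ A) ∧
      ∀ s, (fun a => Q (s, a)) = w s • K s := by
  obtain ⟨K, hK, hQK⟩ := exists_law_prod_eq_mul hQ (fun v => v.2) fun v => v.1
  refine ⟨law Q fun v => v.1, law_mem_stdSimplex hQ _, K, hK, fun s => funext fun a => ?_⟩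
  rw [Pi.smul_apply, smul_eq_mul, ← hQK, ← congrFun (law_id Q) (s, a)]
  exact law_eq_law Q fun v => by simp [Prod.ext_iff, and_comm]

theorem sum_slices_mem_convexHull (hF : ∀ (c : ℝ) (q : A → ℝ), F (c • q) = c • F q)
    (hQ : Q ∈ stdSimplex ℝ (S × A)) :
    ∑ s, F (fun a => Q (s, a)) ∈ convexHull ℝ (F '' stdSimplex ℝ A) := by
  obtain ⟨w, hw, K, hK, hQK⟩ := exists_slice_eq_smul hQ
  simp only [hQK, hF]
  exact mem_convexHull_of_exists_fintype w (fun s => F (K s)) hw.1 hw.2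
    (fun s => Set.mem_image_of_mem F (hK s)) rfl

theorem exists_fin_of_mem_convexHull [FiniteDimensional ℝ V] {s : Set V} {x : V}
    (hx : x ∈ convexHull ℝ s) {k : ℕ} (hk : Module.finrank ℝ V < k) :
    ∃ w ∈ stdSimplex ℝ (Fin k), ∃ z : Fin k → V, (∀ j, z j ∈ s) ∧ ∑ j, w j • z j = x := by
  obtain ⟨ι, _, z, w, hz, hindep, hw, hw1, rfl⟩ := eq_pos_convex_span_of_mem_convexHull hx
  have hcard : Fintype.card ι ≤ Fintype.card (Fin k) := by
    have hspan := hindep.card_le_finrank_succ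
    have hfinrank := Submodule.finrank_le (vectorSpan ℝ (Set.range z))
    rw [Fintype.card_fin]
    lia
  obtain ⟨e⟩ := Function.Embedding.nonempty_of_card_le hcard
  have : Nonempty ι := nonempty_of_mem_stdSimplex ⟨fun i => (hw i).le, hw1⟩
  have hoff (j : Fin k) (hj : j ∉ Set.range e) : Function.extend e w 0 j = 0 :=
    Function.extend_apply' _ _ _ hj
  have hon (i : ι) : Function.extend e w 0 (e i) = w i := e.injective.extend_apply _ _ i
  refine ⟨Function.extend e w 0, ⟨fun j => ?_, ?_⟩, fun j => z (Function.invFun e j),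
    fun j => hz (Set.mem_range_self _), ?_⟩
  · by_cases hj : j ∈ Set.range e
    · obtain ⟨i, rfl⟩ := hj
      exact (hw i).le.trans_eq (hon i).symm
    · exact (hoff j hj).ge
  · rw [← hw1]
    exact (Fintype.sum_of_injective e e.injective _ _ hoff fun i => (hon i).symm).symm
  · refine (Fintype.sum_of_injective e e.injective _ _ (fun j hj => ?_) fun i => ?_).symm
    · rw [hoff j hj, zero_smul]
    · simp only [hon, Function.leftInverse_invFun e.injective i]

theorem exists_fin_sum_slices_eq [FiniteDimensional ℝ V]
    (hF : ∀ (c : ℝ) (q : A → ℝ), F (c • q) = c • F q) {k : ℕ} (hk : Module.finrank ℝ V < k)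
    (hQ : Q ∈ stdSimplex ℝ (S × A)) :
    ∃ Q' ∈ stdSimplex ℝ (Fin k × A), ∑ j, F (fun a => Q' (j, a)) = ∑ s, F (fun a => Q (s, a)) := by
  obtain ⟨w, hw, z, hz, hsum⟩ := exists_fin_of_mem_convexHull (sum_slices_mem_convexHull hF hQ) hk
  choose q hq hqz using hz
  refine ⟨fun v => w v.1 * q v.1 v.2, ⟨fun v => mul_nonneg (hw.1 _) ((hq _).1 _), ?_⟩, ?_⟩
  · simp only [Fintype.sum_prod_type, ← mul_sum, (hq _).2, mul_one, hw.2]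
  · rw [← hsum]
    exact sum_congr rfl fun j _ => (hF (w j) (q j)).trans (congrArg _ (hqz j))

end Caratheodory

section NearlyFeasible

variable {S X Y Z : Type*} [Fintype S] [Fintype X] [Fintype Y] [Fintype Z]

/-- `I(X;S|Y)` for a pmf of `(S, X, Y, Z)`. -/
noncomputable def codingRate (Q : S × X × Y × Z → ℝ) : ℝ :=
  condMutualInfo Q (fun ω => ω.2.1) (fun ω => ω.1) fun ω => ω.2.2.1

/-- `I(Y;S|X)` for a pmf of `(S, X, Y, Z)`; it vanishes iff `S - X - Y` is a Markov chain. -/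
noncomputable def encoderDefect (Q : S × X × Y × Z → ℝ) : ℝ :=
  condMutualInfo Q (fun ω => ω.2.2.1) (fun ω => ω.1) fun ω => ω.2.1

/-- `I(X;Z|S,Y)` for a pmf of `(S, X, Y, Z)`; it vanishes iff `X - (S, Y) - Z` is a Markov
chain. -/
noncomputable def decoderDefect (Q : S × X × Y × Z → ℝ) : ℝ :=
  condMutualInfo Q (fun ω => ω.2.1) (fun ω => ω.2.2.2) fun ω => (ω.1, ω.2.2.1)

/-- A vector `q` together with the conditional entropies `H(X|Y)`, `H(Y|X)` and `H(X|Z,Y)`. Its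
sum over the slices of a pmf of `(S, X, Y, Z)` determines the law of `(X, Y, Z)` and the three
information quantities above. -/
noncomputable def entropyProfile (q : X × Y × Z → ℝ) : (X × Y × Z → ℝ) × ℝ × ℝ × ℝ :=
  (q, condEntropy q (fun t => t.1) (fun t => t.2.1), condEntropy q (fun t => t.2.1) (fun t => t.1),
    condEntropy q (fun t => t.1) (fun t => (t.2.2, t.2.1)))

theorem entropyProfile_smul (c : ℝ) (q : X × Y × Z → ℝ) :
    entropyProfile (c • q) = c • entropyProfile q := by
  simp only [entropyProfile, condEntropy_smul, Prod.smul_mk, smul_eq_mul]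

theorem sum_entropyProfile_slices (Q : S × X × Y × Z → ℝ) :
    ∑ s, entropyProfile (fun t => Q (s, t)) =
      (law Q (fun ω => ω.2), condEntropy Q (fun ω => ω.2.1) (fun ω => (ω.1, ω.2.2.1)),
        condEntropy Q (fun ω => ω.2.2.1) (fun ω => (ω.1, ω.2.1)),
        condEntropy Q (fun ω => ω.2.1) (fun ω => (ω.2.2.2, ω.1, ω.2.2.1))) := by
  have hXZ : condEntropy Q (fun ω => ω.2.1) (fun ω => (ω.2.2.2, ω.1, ω.2.2.1))
      = condEntropy Q (fun ω => ω.2.1) (fun ω => (ω.1, ω.2.2.2, ω.2.2.1)) :=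
    condEntropy_congr Q (fun _ _ => Iff.rfl) fun v w => by
      simp only [Prod.mk.injEq, and_left_comm]
  rw [hXZ, condEntropy_prod_eq_sum Q (fun _ t => t.1) fun _ t => t.2.1,
    condEntropy_prod_eq_sum Q (fun _ t => t.2.1) fun _ t => t.1,
    condEntropy_prod_eq_sum Q (fun _ t => t.1) fun _ t => (t.2.2, t.2.1)]
  simp only [entropyProfile, Prod.ext_iff, Prod.fst_sum, Prod.snd_sum, and_self, and_true]
  funext t
  rw [← sum_law_prod_left Q (fun ω => ω.1), law_id, Finset.sum_apply]

theorem exists_fin_auxiliary {Q : S × X × Y × Z → ℝ} (hQ : Q ∈ stdSimplex ℝ (S × X × Y × Z)) :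
    ∃ Q' ∈ stdSimplex ℝ (Fin (Fintype.card (X × Y × Z) + 4) × X × Y × Z),
      law Q' (fun ω => ω.2) = law Q (fun ω => ω.2) ∧ codingRate Q' = codingRate Q ∧
      encoderDefect Q' = encoderDefect Q ∧ decoderDefect Q' = decoderDefect Q := by
  have hfinrank : Module.finrank ℝ ((X × Y × Z → ℝ) × ℝ × ℝ × ℝ)
      < Fintype.card (X × Y × Z) + 4 := by
    simp only [Module.finrank_prod, Module.finrank_fintype_fun_eq_card, Module.finrank_self]
    lia
  obtain ⟨Q', hQ', hprofile⟩ := exists_fin_sum_slices_eq entropyProfile_smul hfinrank hQ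
  simp only [sum_entropyProfile_slices, Prod.mk.injEq] at hprofile
  obtain ⟨hlaw, hX_SY, hY_SX, hX_ZSY⟩ := hprofile
  have hX_Y := congrArg (condEntropy · (fun t => t.1) fun t => t.2.1) hlaw
  have hY_X := congrArg (condEntropy · (fun t => t.2.1) fun t => t.1) hlaw
  simp only [condEntropy_law] at hX_Y hY_X
  refine ⟨Q', hQ', hlaw, ?_, ?_, ?_⟩
  · rw [codingRate, codingRate, condMutualInfo, condMutualInfo, hX_Y, hX_SY]
  · rw [encoderDefect, encoderDefect, condMutualInfo, condMutualInfo, hY_X, hY_SX]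
  · rw [decoderDefect, decoderDefect, condMutualInfo, condMutualInfo, hX_SY, hX_ZSY]

/-- The pmf `Q` of `(S, X, Y, Z)` meets the distortion constraint, and the other constraints of
`feasibleRates` up to `δ`: the law of `(X, Y)` is within relative entropy `δ` of `P`, and the
Markov chains `S - X - Y` and `X - (S, Y) - Z` hold up to a conditional mutual information `δ`. -/
structure IsNearlyFeasible (P : X × Y → ℝ) (d : X → Z → ℝ) (D δ : ℝ) (Q : S × X × Y × Z → ℝ) :
    Prop where
  mem_stdSimplex : Q ∈ stdSimplex ℝ (S × X × Y × Z)
  support : ∀ xy, P xy = 0 → law Q (fun ω => (ω.2.1, ω.2.2.1)) xy = 0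
  relEntropy_le : relEntropy (law Q fun ω => (ω.2.1, ω.2.2.1)) P ≤ δ
  encoderDefect_le : encoderDefect Q ≤ δ
  decoderDefect_le : decoderDefect Q ≤ δ
  distortion_le : ∑ ω, Q ω * d ω.2.1 ω.2.2.2 ≤ D

variable {P : X × Y → ℝ} {d : X → Z → ℝ} {D δ : ℝ} {Q : S × X × Y × Z → ℝ}

theorem IsNearlyFeasible.mono (hQ : IsNearlyFeasible P d D δ Q) {δ' : ℝ} (hδ : δ ≤ δ') :
    IsNearlyFeasible P d D δ' Q where
  __ := hQ
  relEntropy_le := hQ.relEntropy_le.trans hδ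
  encoderDefect_le := hQ.encoderDefect_le.trans hδ
  decoderDefect_le := hQ.decoderDefect_le.trans hδ

theorem IsNearlyFeasible.exists_fin (hQ : IsNearlyFeasible P d D δ Q) :
    ∃ Q' : Fin (Fintype.card (X × Y × Z) + 4) × X × Y × Z → ℝ,
      IsNearlyFeasible P d D δ Q' ∧ codingRate Q' = codingRate Q := by
  obtain ⟨Q', hQ', hlaw, hrate, hencoder, hdecoder⟩ := exists_fin_auxiliary hQ.mem_stdSimplex
  have hsource := congrArg (law · fun t => (t.1, t.2.1)) hlaw
  have hcost := congrArg (fun q => ∑ t, q t * d t.1 t.2.2) hlaw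
  simp only [law_law] at hsource
  simp only [sum_law_mul _ _ fun t : X × Y × Z => d t.1 t.2.2] at hcost
  exact ⟨Q', ⟨hQ', hsource ▸ hQ.support, hsource ▸ hQ.relEntropy_le, hencoder ▸ hQ.encoderDefect_le,
    hdecoder ▸ hQ.decoderDefect_le, hcost.trans_le hQ.distortion_le⟩, hrate⟩

variable {W : X → S → ℝ} {V : S → Y → Z → ℝ}

theorem law_jointPmf_encoder (P : X × Y → ℝ) (W : X → S → ℝ) (hV : ∀ s y, V s y ∈ stdSimplex ℝ Z)
    (s : S) (x : X) (y : Y) :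
    law (jointPmf P W V) (fun ω => (ω.1, ω.2.1, ω.2.2.1)) (s, x, y) = W x s * P (x, y) := by
  classical
  simp only [law, Fintype.sum_prod_type, Prod.mk.injEq, jointPmf, ite_and]
  simp [← mul_sum, (hV _ _).2]

theorem law_jointPmf_source (P : X × Y → ℝ) (hW : ∀ x, W x ∈ stdSimplex ℝ S)
    (hV : ∀ s y, V s y ∈ stdSimplex ℝ Z) :
    law (jointPmf P W V) (fun ω => (ω.2.1, ω.2.2.1)) = P := by
  funext ⟨x, y⟩
  simp only [← sum_law_prod_left _ (fun ω : S × X × Y × Z => ω.1) fun ω => (ω.2.1, ω.2.2.1),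
    law_jointPmf_encoder P W hV, ← sum_mul, (hW x).2, one_mul]

theorem jointPmf_mem_stdSimplex (hP : P ∈ stdSimplex ℝ (X × Y)) (hW : ∀ x, W x ∈ stdSimplex ℝ S)
    (hV : ∀ s y, V s y ∈ stdSimplex ℝ Z) :
    jointPmf P W V ∈ stdSimplex ℝ (S × X × Y × Z) := by
  refine ⟨fun ω => mul_nonneg (mul_nonneg ((hW _).1 _) (hP.1 _)) ((hV _ _).1 _), ?_⟩
  rw [← sum_law _ fun ω : S × X × Y × Z => (ω.2.1, ω.2.2.1), law_jointPmf_source P hW hV, hP.2]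

theorem jointPmf_eq_iff (hW : ∀ x, W x ∈ stdSimplex ℝ S) (hV : ∀ s y, V s y ∈ stdSimplex ℝ Z) :
    jointPmf P W V = Q ↔ law Q (fun ω => (ω.2.1, ω.2.2.1)) = P ∧
      (∀ y s x, law Q (fun ω => (ω.2.2.1, ω.1, ω.2.1)) (y, s, x)
        = law Q (fun ω => (ω.2.2.1, ω.2.1)) (y, x) * W x s) ∧
      ∀ x z sy, law Q (fun ω => (ω.2.1, ω.2.2.2, (ω.1, ω.2.2.1))) (x, z, sy)
        = law Q (fun ω => (ω.2.1, (ω.1, ω.2.2.1))) (x, sy) * V sy.1 sy.2 z := by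
  have hYSX (y s x) : law Q (fun ω => (ω.2.2.1, ω.1, ω.2.1)) (y, s, x)
      = law Q (fun ω => (ω.1, ω.2.1, ω.2.2.1)) (s, x, y) :=
    law_eq_law Q fun ω => by simp only [Prod.mk.injEq]; tauto
  have hYX (y x) : law Q (fun ω => (ω.2.2.1, ω.2.1)) (y, x)
      = law Q (fun ω => (ω.2.1, ω.2.2.1)) (x, y) :=
    law_eq_law Q fun ω => by simp only [Prod.mk.injEq, and_comm]
  have hXZSY (x z s y) : law Q (fun ω => (ω.2.1, ω.2.2.2, (ω.1, ω.2.2.1))) (x, z, (s, y))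
      = Q (s, x, y, z) :=
    (law_eq_law Q fun ω => by simp only [Prod.ext_iff]; tauto).trans (congrFun (law_id Q) _)
  have hXSY (x s y) : law Q (fun ω => (ω.2.1, (ω.1, ω.2.2.1))) (x, (s, y))
      = law Q (fun ω => (ω.1, ω.2.1, ω.2.2.1)) (s, x, y) :=
    law_eq_law Q fun ω => by simp only [Prod.mk.injEq, and_left_comm]
  simp only [Prod.forall, hYSX, hYX, hXZSY, hXSY]
  constructor
  · rintro rfl
    simp only [law_jointPmf_source P hW hV, law_jointPmf_encoder P W hV, jointPmf, mul_comm,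
      implies_true, and_self]
  · rintro ⟨hsource, hencoder, hdecoder⟩
    ext ⟨s, x, y, z⟩
    rw [hdecoder, hencoder, hsource, jointPmf, mul_comm (W x s)]

theorem isNearlyFeasible_zero_iff (hP : P ∈ stdSimplex ℝ (X × Y)) :
    IsNearlyFeasible P d D 0 Q ↔
      ∃ (W : X → S → ℝ) (V : S → Y → Z → ℝ), (∀ x, W x ∈ stdSimplex ℝ S) ∧
        (∀ s y, V s y ∈ stdSimplex ℝ Z) ∧ ∑ ω, Q ω * d ω.2.1 ω.2.2.2 ≤ D ∧ jointPmf P W V = Q := by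
  constructor
  · rintro ⟨hQ, hsupport, hdiv, hencoder, hdecoder, hcost⟩
    have hsource := (relEntropy_eq_zero_iff (law_nonneg hQ.1 _) hP.1 hsupport).1
      (hdiv.antisymm (relEntropy_nonneg (law_nonneg hQ.1 _) hP.1))
    obtain ⟨W, hW, hencoder⟩ := (condMutualInfo_eq_zero_iff hQ _ _ _).1
      (hencoder.antisymm (condMutualInfo_nonneg hQ.1 _ _ _))
    obtain ⟨V, hV, hdecoder⟩ := (condMutualInfo_eq_zero_iff hQ _ _ _).1
      (hdecoder.antisymm (condMutualInfo_nonneg hQ.1 _ _ _))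
    exact ⟨W, fun s y => V (s, y), hW, fun s y => hV (s, y), hcost,
      (jointPmf_eq_iff hW fun s y => hV (s, y)).2 ⟨hsource, hencoder, hdecoder⟩⟩
  · rintro ⟨W, V, hW, hV, hcost, hQW⟩
    have hQ : Q ∈ stdSimplex ℝ (S × X × Y × Z) := hQW ▸ jointPmf_mem_stdSimplex hP hW hV
    obtain ⟨hsource, hencoder, hdecoder⟩ := (jointPmf_eq_iff hW hV).1 hQW
    refine ⟨hQ, fun xy h => by rw [hsource, h], ?_,
      ((condMutualInfo_eq_zero_iff hQ _ _ _).2 ⟨W, hW, hencoder⟩).le,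
      ((condMutualInfo_eq_zero_iff hQ _ _ _).2
        ⟨fun sy => V sy.1 sy.2, fun sy => hV sy.1 sy.2, hdecoder⟩).le, hcost⟩
    rw [hsource]
    exact ((relEntropy_eq_zero_iff hP.1 hP.1 fun _ => id).2 rfl).le

theorem feasibleRates_eq_image (hP : P ∈ stdSimplex ℝ (X × Y)) (d : X → Z → ℝ) (D : ℝ) :
    feasibleRates P d D =
      codingRate '' {Q : Fin (Fintype.card (X × Y × Z) + 4) × X × Y × Z → ℝ |
        IsNearlyFeasible P d D 0 Q} := by
  ext r
  constructor
  · rintro ⟨k, W, V, hW, hV, hcost, rfl⟩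
    exact ((isNearlyFeasible_zero_iff hP).2 ⟨W, V, hW, hV, hcost, rfl⟩).exists_fin
  · rintro ⟨Q, hQ, rfl⟩
    obtain ⟨W, V, hW, hV, hcost, rfl⟩ := (isNearlyFeasible_zero_iff hP).1 hQ
    exact ⟨_, W, V, hW, hV, hcost, rfl⟩

variable (S) in
theorem isClosed_setOf_isNearlyFeasible (P : X × Y → ℝ) (d : X → Z → ℝ) (D : ℝ) :
    IsClosed {v : ℝ × (S × X × Y × Z → ℝ) | IsNearlyFeasible P d D v.1 v.2} := by
  have hlaw : Continuous fun v : ℝ × (S × X × Y × Z → ℝ) =>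
      law v.2 fun ω => (ω.2.1, ω.2.2.1) := (continuous_law _).comp continuous_snd
  have hencoder : Continuous fun v : ℝ × (S × X × Y × Z → ℝ) => encoderDefect v.2 :=
    (continuous_condMutualInfo _ _ _).comp continuous_snd
  have hdecoder : Continuous fun v : ℝ × (S × X × Y × Z → ℝ) => decoderDefect v.2 :=
    (continuous_condMutualInfo _ _ _).comp continuous_snd
  have hsupport : IsClosed {v : ℝ × (S × X × Y × Z → ℝ) |
      ∀ xy, P xy = 0 → law v.2 (fun ω => (ω.2.1, ω.2.2.1)) xy = 0} := by
    simp only [Set.ofPred_forall]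
    exact isClosed_iInter fun xy => isClosed_iInter fun _ =>
      isClosed_eq ((continuous_apply xy).comp hlaw) continuous_const
  have hclosed := ((isClosed_stdSimplex ℝ _).preimage continuous_snd).inter <| hsupport.inter <|
    (isClosed_le ((continuous_relEntropy_left P).comp hlaw) continuous_fst).inter <|
    (isClosed_le hencoder continuous_fst).inter <| (isClosed_le hdecoder continuous_fst).inter <|
    isClosed_le (f := fun v : ℝ × (S × X × Y × Z → ℝ) => ∑ ω, v.2 ω * d ω.2.1 ω.2.2.2)
      (g := fun _ => D) (by fun_prop) continuous_const
  convert hclosed using 1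
  ext v
  exact ⟨fun ⟨h₁, h₂, h₃, h₄, h₅, h₆⟩ => ⟨h₁, h₂, h₃, h₄, h₅, h₆⟩,
    fun ⟨h₁, h₂, h₃, h₄, h₅, h₆⟩ => ⟨h₁, h₂, h₃, h₄, h₅, h₆⟩⟩

theorem isCompact_feasibleRates (hP : P ∈ stdSimplex ℝ (X × Y)) (d : X → Z → ℝ) (D : ℝ) :
    IsCompact (feasibleRates P d D) := by
  rw [feasibleRates_eq_image hP]
  refine IsCompact.image ?_ (continuous_condMutualInfo _ _ _)
  exact (isCompact_stdSimplex ℝ _).of_isClosed_subset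
    ((isClosed_setOf_isNearlyFeasible _ P d D).preimage (Continuous.prodMk_right 0))
    fun Q hQ => hQ.mem_stdSimplex

theorem exists_isNearlyFeasible_zero_of_tendsto {ι : Type*} {l : Filter ι} [NeBot l] {u : ι → ℝ}
    {R : ℝ} (hu : Tendsto u l (𝓝 0)) (h : ∀ᶠ i in l, ∃ Q : S × X × Y × Z → ℝ,
      IsNearlyFeasible P d D (u i) Q ∧ codingRate Q ≤ R + u i) :
    ∃ Q : S × X × Y × Z → ℝ, IsNearlyFeasible P d D 0 Q ∧ codingRate Q ≤ R := by
  set K := {v : ℝ × (S × X × Y × Z → ℝ) |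
    IsNearlyFeasible P d D v.1 v.2 ∧ codingRate v.2 ≤ R + v.1}
  have hclosed : IsClosed K := (isClosed_setOf_isNearlyFeasible S P d D).inter <|
    isClosed_le ((continuous_condMutualInfo _ _ _).comp continuous_snd)
      (continuous_const.add continuous_fst)
  have hcompact := ((isCompact_Icc (a := (-1 : ℝ)) (b := 1)).prod
    (isCompact_stdSimplex ℝ (S × X × Y × Z))).inter_left hclosed
  have hmem : (0 : ℝ) ∈ Prod.fst '' (K ∩ Set.Icc (-1 : ℝ) 1 ×ˢ stdSimplex ℝ (S × X × Y × Z)) := by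
    refine (hcompact.image continuous_fst).isClosed.mem_of_tendsto hu ?_
    filter_upwards [h, hu (Icc_mem_nhds neg_one_lt_zero one_pos)] with i ⟨Q, hQ, hR⟩ hi
    exact ⟨(u i, Q), ⟨⟨hQ, hR⟩, hi, hQ.mem_stdSimplex⟩, rfl⟩
  obtain ⟨⟨_, Q⟩, ⟨⟨hQ, hR⟩, -⟩, rfl⟩ := hmem
  exact ⟨Q, hQ, by simpa using hR⟩

theorem exists_feasibleRate_le_of_tendsto (hP : P ∈ stdSimplex ℝ (X × Y)) {ι : Type*}
    {l : Filter ι} [NeBot l] {u : ι → ℝ} {R : ℝ} (hu : Tendsto u l (𝓝 0)) {T : ι → Type*}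
    [∀ i, Fintype (T i)] (h : ∀ᶠ i in l, ∃ Q : T i × X × Y × Z → ℝ,
      IsNearlyFeasible P d D (u i) Q ∧ codingRate Q ≤ R + u i) :
    ∃ r ∈ feasibleRates P d D, r ≤ R := by
  have hfin : ∀ᶠ i in l, ∃ Q : Fin (Fintype.card (X × Y × Z) + 4) × X × Y × Z → ℝ,
      IsNearlyFeasible P d D (u i) Q ∧ codingRate Q ≤ R + u i := by
    filter_upwards [h] with i ⟨Q, hQ, hR⟩
    obtain ⟨Q', hQ', hrate⟩ := hQ.exists_fin
    exact ⟨Q', hQ', hrate.trans_le hR⟩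
  obtain ⟨Q, hQ, hR⟩ := exists_isNearlyFeasible_zero_of_tendsto hu hfin
  exact ⟨codingRate Q, feasibleRates_eq_image hP d D ▸ ⟨Q, hQ, rfl⟩, hR⟩

end NearlyFeasible

section CsiszarSum

variable {Ω M A X Y : Type*} [Fintype Ω] [Fintype M] [Fintype A] [Fintype X] [Fintype Y] {n : ℕ}

open Classical in
/-- The entries of the tuple `a` with index in `s`; the other entries are erased. -/
noncomputable def mask {ι A : Type*} (s : Set ι) (a : ι → A) (i : ι) : Option A :=
  if i ∈ s then some (a i) else none

theorem mask_eq_mask_iff {ι A : Type*} {s : Set ι} {a b : ι → A} :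
    mask s a = mask s b ↔ s.EqOn a b := by
  simp only [funext_iff, mask, Set.EqOn]
  refine forall_congr' fun i => ?_
  by_cases hi : i ∈ s <;> simp [hi]

theorem mask_insert_eq_iff {ι A : Type*} {s t : Set ι} {i : ι} (hst : t = insert i s)
    {a b : ι → A} : mask t a = mask t b ↔ a i = b i ∧ mask s a = mask s b := by
  simp [mask_eq_mask_iff, hst, Set.EqOn]

/-- The auxiliary random variable `U_i = (M, X_1, …, X_{i-1}, Y_{i+1}, …, Y_n)`. -/
noncomputable def auxiliary {Ω M X Y : Type*} (m : Ω → M) (x : Ω → Fin n → X)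
    (y : Ω → Fin n → Y) (i : Fin n) (ω : Ω) : M × (Fin n → Option X) × (Fin n → Option Y) :=
  (m ω, mask (Set.Iio i) (x ω), mask (Set.Ioi i) (y ω))

theorem sum_condEntropy_sub_condEntropy_auxiliary (p : Ω → ℝ) (m : Ω → M) (x : Ω → Fin n → X)
    (y : Ω → Fin n → Y) :
    ∑ i, (condEntropy p (fun ω => x ω i) (fun ω => (auxiliary m x y i ω, y ω i))
        - condEntropy p (fun ω => y ω i) (fun ω => (auxiliary m x y i ω, x ω i)))
      = entropy p (fun ω => (m ω, x ω)) - entropy p (fun ω => (m ω, y ω)) := by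
  -- Csiszár sum identity: every summand is an increment of `F`, which interpolates between
  -- `H(M, Y^n)` and `H(M, X^n)`.
  let F (k : ℕ) : ℝ :=
    entropy p fun ω => (m ω, mask {j : Fin n | j < k} (x ω), mask {j : Fin n | k ≤ j} (y ω))
  have hlt (i : Fin n) : {j : Fin n | j < (i + 1 : ℕ)} = insert i (Set.Iio i) := by
    ext; simp
  have hle (i : Fin n) : {j : Fin n | (i : ℕ) ≤ j} = insert i (Set.Ioi i) := by
    ext; simp
  have hstep (i : Fin n) :
      condEntropy p (fun ω => x ω i) (fun ω => (auxiliary m x y i ω, y ω i))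
        - condEntropy p (fun ω => y ω i) (fun ω => (auxiliary m x y i ω, x ω i))
        = F (i + 1) - F i := by
    have hxy : entropy p (fun ω => (x ω i, auxiliary m x y i ω, y ω i))
        = entropy p (fun ω => (y ω i, auxiliary m x y i ω, x ω i)) :=
      entropy_congr p fun ω ω' => by simp only [Prod.mk.injEq]; tauto
    have hy : entropy p (fun ω => (auxiliary m x y i ω, y ω i)) = F i :=
      entropy_congr p fun ω ω' => by
        simp only [auxiliary, Prod.mk.injEq, mask_insert_eq_iff (hle i)]; tauto
    have hx : entropy p (fun ω => (auxiliary m x y i ω, x ω i)) = F (i + 1) :=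
      entropy_congr p fun ω ω' => by
        simp only [auxiliary, Prod.mk.injEq, mask_insert_eq_iff (hlt i)]; tauto
    rw [condEntropy, condEntropy, hxy, hy, hx]
    ring
  rw [sum_congr rfl fun i _ => hstep i,
    Fin.sum_univ_eq_sum_range (fun i => F (i + 1) - F i) n, sum_range_sub]
  congr 1 <;> refine entropy_congr p fun ω ω' => ?_ <;>
    simp only [Prod.mk.injEq, mask_eq_mask_iff] <;> simp [Set.EqOn, funext_iff]

theorem sum_condEntropy_mask_Iio (p : Ω → ℝ) (f : Ω → Fin n → A) (h : Ω → M) :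
    ∑ i, condEntropy p (fun ω => f ω i) (fun ω => (h ω, mask (Set.Iio i) (f ω)))
      = condEntropy p f h := by
  have hunit (i : Fin n) (u : Ω → M × (Fin n → Option A) × (Fin n → Option Unit)) :
      condEntropy p (fun _ => ()) (fun ω => (u ω, f ω i)) = 0 :=
    sub_eq_zero.2 (entropy_congr p fun ω ω' => by simp)
  have hsum := sum_condEntropy_sub_condEntropy_auxiliary p h f fun _ _ => ()
  simp only [hunit, sub_zero] at hsum
  calc ∑ i, condEntropy p (fun ω => f ω i) (fun ω => (h ω, mask (Set.Iio i) (f ω)))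
      = ∑ i, condEntropy p (fun ω => f ω i)
          (fun ω => (auxiliary h f (fun _ _ => ()) i ω, ())) :=
        sum_congr rfl fun i _ => condEntropy_congr p (fun _ _ => Iff.rfl) fun ω ω' => by
          simp [auxiliary]
    _ = entropy p (fun ω => (h ω, f ω)) - entropy p (fun ω => (h ω, fun _ : Fin n => ())) := hsum
    _ = condEntropy p f h := congrArg₂ (· - ·)
        (entropy_congr p fun ω ω' => by simp only [Prod.mk.injEq, and_comm])
        (entropy_congr p fun ω ω' => by simp)

end CsiszarSum

section SingleLetter

variable {Ω M X Y Z : Type*} [Fintype Ω] [Fintype M] [Fintype X] [Fintype Y] [Fintype Z] {n : ℕ}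
  {p : Ω → ℝ} {m : Ω → M} {x : Ω → Fin n → X} {y : Ω → Fin n → Y} {z : Ω → Fin n → Z}

/-- The pmf of `((T, U_T), X_T, Y_T, Z_T)` for a time index `T` that is uniform and independent of
`(M, X^n, Y^n, Z^n)`. -/
noncomputable def singleLetter (p : Ω → ℝ) (m : Ω → M) (x : Ω → Fin n → X) (y : Ω → Fin n → Y)
    (z : Ω → Fin n → Z) :
    (Fin n × M × (Fin n → Option X) × (Fin n → Option Y)) × X × Y × Z → ℝ :=
  law (timeShare (Fin n) p) fun v =>
    ((v.1, auxiliary m x y v.1 v.2), x v.2 v.1, y v.2 v.1, z v.2 v.1)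

theorem law_source_singleLetter (p : Ω → ℝ) (m : Ω → M) (x : Ω → Fin n → X) (y : Ω → Fin n → Y)
    (z : Ω → Fin n → Z) : law (singleLetter p m x y z) (fun ω => (ω.2.1, ω.2.2.1))
      = law (timeShare (Fin n) p) fun v => (x v.2 v.1, y v.2 v.1) :=
  law_law _ _ _

variable [NeZero n]

theorem singleLetter_mem_stdSimplex (hp : p ∈ stdSimplex ℝ Ω) (m : Ω → M) (x : Ω → Fin n → X)
    (y : Ω → Fin n → Y) (z : Ω → Fin n → Z) : singleLetter p m x y z ∈ stdSimplex ℝ _ :=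
  law_mem_stdSimplex (timeShare_mem_stdSimplex hp) _

theorem mul_condEntropy_singleLetter {A C : Type*} [Fintype A] [Fintype C]
    (f : X × Y × Z → A) (h : X × Y × Z → C) :
    n * condEntropy (singleLetter p m x y z) (fun ω => f ω.2) (fun ω => (ω.1, h ω.2))
      = ∑ i, condEntropy p (fun ω => f (x ω i, y ω i, z ω i))
          (fun ω => (auxiliary m x y i ω, h (x ω i, y ω i, z ω i))) := by
  rw [← card_mul_condEntropy_timeShare, Fintype.card_fin, singleLetter, condEntropy_law]
  congr 1
  exact condEntropy_congr _ (fun _ _ => Iff.rfl) fun v w => by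
    simp only [Prod.mk.injEq, and_assoc]

theorem mul_condEntropy_sub_condEntropy_singleLetter (p : Ω → ℝ) (m : Ω → M) (x : Ω → Fin n → X)
    (y : Ω → Fin n → Y) (z : Ω → Fin n → Z) :
    n * (condEntropy (singleLetter p m x y z) (fun ω => ω.2.1) (fun ω => (ω.1, ω.2.2.1))
        - condEntropy (singleLetter p m x y z) (fun ω => ω.2.2.1) (fun ω => (ω.1, ω.2.1)))
      = entropy p (fun ω => (m ω, x ω)) - entropy p (fun ω => (m ω, y ω)) := by
  rw [← sum_condEntropy_sub_condEntropy_auxiliary, mul_sub, sum_sub_distrib,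
    mul_condEntropy_singleLetter (fun t => t.1) fun t => t.2.1,
    mul_condEntropy_singleLetter (fun t => t.2.1) fun t => t.1]

theorem entropy_sub_entropy_le_mul_condEntropy_singleLetter (hp : ∀ ω, 0 ≤ p ω)
    (hm : m.FactorsThrough x) (hz : z.FactorsThrough fun ω => (m ω, y ω)) :
    entropy p (fun ω => (x ω, y ω)) - entropy p (fun ω => (m ω, y ω))
      ≤ n * condEntropy (singleLetter p m x y z)
        (fun ω => ω.2.1) (fun ω => (ω.2.2.2, ω.1, ω.2.2.1)) := by
  have hxy : entropy p (fun ω => (x ω, y ω)) = entropy p (fun ω => (x ω, m ω, y ω)) :=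
    entropy_congr p fun ω ω' => by simp only [Prod.mk.injEq]; have := @hm ω ω'; tauto
  have hSZY : condEntropy (singleLetter p m x y z)
        (fun ω => ω.2.1) (fun ω => (ω.2.2.2, ω.1, ω.2.2.1))
      = condEntropy (singleLetter p m x y z)
        (fun ω => ω.2.1) (fun ω => (ω.1, ω.2.2.2, ω.2.2.1)) :=
    condEntropy_congr _ (fun _ _ => Iff.rfl) fun v w => by
      simp only [Prod.mk.injEq, and_left_comm]
  calc entropy p (fun ω => (x ω, y ω)) - entropy p (fun ω => (m ω, y ω))
      = condEntropy p x (fun ω => (m ω, y ω)) := by rw [hxy, condEntropy]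
    _ = ∑ i, condEntropy p (fun ω => x ω i) (fun ω => ((m ω, y ω), mask (Set.Iio i) (x ω))) :=
        (sum_condEntropy_mask_Iio p x _).symm
    _ ≤ ∑ i, condEntropy p (fun ω => x ω i) (fun ω => (auxiliary m x y i ω, z ω i, y ω i)) := by
        refine sum_le_sum fun i _ => condEntropy_anti hp _ fun ω ω' h => ?_
        simp only [Prod.mk.injEq] at h
        obtain ⟨⟨hm, hy⟩, hx⟩ := h
        simp only [auxiliary, hm, hy, hx, hz (Prod.ext hm hy)]
    _ = _ := by
        rw [hSZY, mul_condEntropy_singleLetter (fun t => t.1) fun t => (t.2.2, t.2.1)]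

theorem mul_encoderDefect_add_decoderDefect_le (hp : p ∈ stdSimplex ℝ Ω)
    (hm : m.FactorsThrough x) (hz : z.FactorsThrough fun ω => (m ω, y ω)) :
    n * (encoderDefect (singleLetter p m x y z) + decoderDefect (singleLetter p m x y z))
      ≤ n * entropy (timeShare (Fin n) p) (fun v => (x v.2 v.1, y v.2 v.1))
        - entropy p (fun ω => (x ω, y ω)) := by
  have hsub := mul_condEntropy_sub_condEntropy_singleLetter p m x y z
  have hle := entropy_sub_entropy_le_mul_condEntropy_singleLetter hp.1 hm hz
  have hX := entropy_pi_le_card_mul_entropy_timeShare hp x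
  have hmx : entropy p (fun ω => (m ω, x ω)) = entropy p x :=
    entropy_congr p fun ω ω' => by simpa using @hm ω ω'
  have hY_X : condEntropy (singleLetter p m x y z) (fun ω => ω.2.2.1) (fun ω => ω.2.1)
      = entropy (timeShare (Fin n) p) (fun v => (x v.2 v.1, y v.2 v.1))
        - entropy (timeShare (Fin n) p) (fun v => x v.2 v.1) := by
    rw [singleLetter, condEntropy_law, condEntropy]
    congr 1
    exact entropy_congr _ fun v w => by simp only [Prod.mk.injEq, and_comm]
  rw [Fintype.card_fin] at hX
  rw [encoderDefect, decoderDefect, condMutualInfo, condMutualInfo, hY_X]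
  linarith

theorem mul_codingRate_le (hp : p ∈ stdSimplex ℝ Ω)
    (hm : m.FactorsThrough x) (hz : z.FactorsThrough fun ω => (m ω, y ω)) :
    n * codingRate (singleLetter p m x y z)
      ≤ Real.logb 2 (Fintype.card M)
        + (n * entropy (timeShare (Fin n) p) (fun v => (x v.2 v.1, y v.2 v.1))
          - entropy p (fun ω => (x ω, y ω))) := by
  have hle := entropy_sub_entropy_le_mul_condEntropy_singleLetter hp.1 hm hz
  have hdecoder : 0 ≤ n * decoderDefect (singleLetter p m x y z) :=
    mul_nonneg n.cast_nonneg
      (condMutualInfo_nonneg (singleLetter_mem_stdSimplex hp m x y z).1 _ _ _)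
  have hY := entropy_pi_le_card_mul_entropy_timeShare hp y
  have hmy := entropy_prod_le hp m y
  have hM := entropy_le_logb_card hp m
  have hX_Y : condEntropy (singleLetter p m x y z) (fun ω => ω.2.1) (fun ω => ω.2.2.1)
      = entropy (timeShare (Fin n) p) (fun v => (x v.2 v.1, y v.2 v.1))
        - entropy (timeShare (Fin n) p) (fun v => y v.2 v.1) := by
    rw [singleLetter, condEntropy_law, condEntropy]
  rw [Fintype.card_fin] at hY
  rw [decoderDefect, condMutualInfo] at hdecoder
  rw [codingRate, condMutualInfo, hX_Y]
  linarith

end SingleLetter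

section Conditioning

variable {Ω : Type*} [Fintype Ω] {p : Ω → ℝ} {G : Set Ω}

/-- The probability of the event `G` under the pmf `p`. -/
noncomputable def prob (p : Ω → ℝ) (G : Set Ω) : ℝ :=
  ∑ ω, G.indicator p ω

/-- The pmf `p` conditioned on the event `G`; it is zero if `G` has probability zero. -/
noncomputable def condOn (p : Ω → ℝ) (G : Set Ω) (ω : Ω) : ℝ :=
  G.indicator p ω / prob p G

theorem prob_nonneg (hp : ∀ ω, 0 ≤ p ω) (G : Set Ω) : 0 ≤ prob p G :=
  sum_nonneg fun ω _ => Set.indicator_nonneg (fun ω _ => hp ω) ω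

theorem prob_add_prob_compl (p : Ω → ℝ) (G : Set Ω) : prob p G + prob p Gᶜ = ∑ ω, p ω := by
  rw [prob, prob, ← sum_add_distrib]
  exact sum_congr rfl fun ω _ => congrFun (Set.indicator_self_add_compl G p) ω

theorem condOn_mem_stdSimplex (hp : ∀ ω, 0 ≤ p ω) (hG : prob p G ≠ 0) :
    condOn p G ∈ stdSimplex ℝ Ω := by
  refine ⟨fun ω => div_nonneg (Set.indicator_nonneg (fun ω _ => hp ω) ω) (prob_nonneg hp G), ?_⟩
  simp only [condOn, ← sum_div]
  exact div_self hG

theorem condOn_eq_zero {ω : Ω} (hω : p ω = 0) : condOn p G ω = 0 := by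
  simp [condOn, hω]

theorem mem_of_condOn_ne_zero {ω : Ω} (hω : condOn p G ω ≠ 0) : ω ∈ G :=
  Set.mem_of_indicator_ne_zero (div_ne_zero_iff.1 hω).1

theorem relEntropy_condOn (hp : p ∈ stdSimplex ℝ Ω) (hG : prob p G ≠ 0) :
    relEntropy (condOn p G) p = -Real.logb 2 (prob p G) := by
  have hcond := condOn_mem_stdSimplex hp.1 hG
  have hterm (ω : Ω) : condOn p G ω * (Real.logb 2 (condOn p G ω) - Real.logb 2 (p ω))
      = condOn p G ω * -Real.logb 2 (prob p G) := by
    rcases eq_or_ne (condOn p G ω) 0 with hω | hω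
    · simp [hω]
    · have hpω : p ω ≠ 0 := mt condOn_eq_zero hω
      have hval : condOn p G ω = p ω / prob p G := by
        rw [condOn, Set.indicator_of_mem (mem_of_condOn_ne_zero hω)]
      rw [hval, Real.logb_div hpω hG, sub_sub_cancel_left]
  rw [relEntropy_eq_sum_mul_logb_sub (fun ω => condOn_eq_zero) (hcond.2.trans hp.2.symm),
    sum_congr rfl fun ω _ => hterm ω, ← sum_mul, hcond.2, one_mul]

end Conditioning

section Iid

variable {ι A : Type*} [Fintype ι] [Fintype A] {P : A → ℝ} {p : (ι → A) → ℝ}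

variable (ι) in
/-- The joint pmf of independent samples from `P`, indexed by `ι`. -/
def iid (P : A → ℝ) (ω : ι → A) : ℝ :=
  ∏ i, P (ω i)

theorem iid_mem_stdSimplex [DecidableEq ι] (hP : P ∈ stdSimplex ℝ A) :
    iid ι P ∈ stdSimplex ℝ (ι → A) := by
  refine ⟨fun ω => prod_nonneg fun i _ => hP.1 (ω i), ?_⟩
  simp only [iid]
  rw [← Fintype.prod_sum (fun (_ : ι) a => P a)]
  simp [hP.2]

variable [DecidableEq ι]

theorem law_timeShare_eq_zero (hac : ∀ ω, iid ι P ω = 0 → p ω = 0) {a : A} (ha : P a = 0) :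
    law (timeShare ι p) (fun v => v.2 v.1) a = 0 := by
  classical
  refine sum_eq_zero fun v _ => ite_eq_right_iff.2 fun hv => ?_
  have hiid : iid ι P v.2 = 0 := prod_eq_zero (mem_univ v.1) (by rw [← ha, ← hv])
  rw [timeShare, hac v.2 hiid, mul_zero]

theorem relEntropy_iid [Nonempty ι] (hP : P ∈ stdSimplex ℝ A) (hp : p ∈ stdSimplex ℝ (ι → A))
    (hac : ∀ ω, iid ι P ω = 0 → p ω = 0) :
    relEntropy p (iid ι P) =
      (Fintype.card ι * entropy (timeShare ι p) (fun v => v.2 v.1) - entropy p fun ω => ω)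
        + Fintype.card ι * relEntropy (law (timeShare ι p) fun v => v.2 v.1) P := by
  have hmarginal : law (timeShare ι p) (fun v => v.2 v.1) ∈ stdSimplex ℝ A :=
    law_mem_stdSimplex (timeShare_mem_stdSimplex hp) _
  have hcross : Fintype.card ι *
        ∑ a, law (timeShare ι p) (fun v => v.2 v.1) a * Real.logb 2 (P a)
      = ∑ ω, p ω * Real.logb 2 (iid ι P ω) := by
    rw [sum_law_mul, sum_timeShare_mul p fun v : ι × (ι → A) => Real.logb 2 (P (v.2 v.1)),
      mul_inv_cancel_left₀ (by positivity), sum_comm]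
    refine sum_congr rfl fun ω _ => ?_
    rcases eq_or_ne (p ω) 0 with hω | hω
    · simp [hω]
    · rw [iid, Real.logb_prod _ _ (prod_ne_zero_iff.1 (mt (hac ω) hω)), mul_sum]
  rw [relEntropy_eq_sum_mul_logb_sub hac (hp.2.trans (iid_mem_stdSimplex hP).2.symm),
    relEntropy_eq_sum_mul_logb_sub (fun a => law_timeShare_eq_zero hac)
      (hmarginal.2.trans hP.2.symm)]
  simp only [mul_sub, sum_sub_distrib, hcross]
  rw [entropy_eq_neg_sum_mul_logb p, entropy_eq_neg_sum_mul_logb (timeShare ι p), law_id,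
    sum_law_mul (F := fun a => Real.logb 2 (law (timeShare ι p) (fun v => v.2 v.1) a))]
  ring

theorem card_mul_entropy_timeShare_sub_entropy_le [Nonempty ι] (hP : P ∈ stdSimplex ℝ A)
    (hp : p ∈ stdSimplex ℝ (ι → A)) (hac : ∀ ω, iid ι P ω = 0 → p ω = 0) :
    Fintype.card ι * entropy (timeShare ι p) (fun v => v.2 v.1) - entropy p (fun ω => ω)
      ≤ relEntropy p (iid ι P) := by
  rw [relEntropy_iid hP hp hac]
  exact le_add_of_nonneg_right <| mul_nonneg (Nat.cast_nonneg _) <|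
    relEntropy_nonneg (law_nonneg (timeShare_mem_stdSimplex hp).1 _) hP.1

theorem card_mul_relEntropy_law_timeShare_le [Nonempty ι] (hP : P ∈ stdSimplex ℝ A)
    (hp : p ∈ stdSimplex ℝ (ι → A)) (hac : ∀ ω, iid ι P ω = 0 → p ω = 0) :
    Fintype.card ι * relEntropy (law (timeShare ι p) fun v => v.2 v.1) P
      ≤ relEntropy p (iid ι P) := by
  rw [relEntropy_iid hP hp hac]
  exact le_add_of_nonneg_left <|
    sub_nonneg.2 (entropy_pi_le_card_mul_entropy_timeShare hp fun ω => ω)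

end Iid

section Codes

variable {X Y Z M : Type*} [Fintype X] [Fintype Y] {P : X × Y → ℝ} {d : X → Z → ℝ} {D : ℝ}

theorem prob_setOf_le_eq_one_sub_excessProb {n : ℕ} (hP : P ∈ stdSimplex ℝ (X × Y))
    (d : X → Z → ℝ) (D : ℝ) (φ : (Fin n → X) → M) (g : M → (Fin n → Y) → (Fin n → Z)) :
    prob (iid (Fin n) P) {ω | 1 / (n : ℝ) *
        ∑ i, d (ω i).1 (g (φ fun j => (ω j).1) (fun j => (ω j).2) i) ≤ D}
      = 1 - excessProb P d D φ g := by
  classical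
  set G : Set (Fin n → X × Y) := {ω | 1 / (n : ℝ) *
    ∑ i, d (ω i).1 (g (φ fun j => (ω j).1) (fun j => (ω j).2) i) ≤ D} with hG
  have hexcess : excessProb P d D φ g = prob (iid (Fin n) P) Gᶜ :=
    sum_congr rfl fun ω _ => by simp [hG, Set.indicator_apply, iid]
  rw [hexcess, eq_sub_iff_add_eq, prob_add_prob_compl, (iid_mem_stdSimplex hP).2]

variable [Fintype Z] [Fintype M]

theorem sum_singleLetter_mul_le {Ω : Type*} [Fintype Ω] {n : ℕ} {p : Ω → ℝ}
    (hp : p ∈ stdSimplex ℝ Ω) (m : Ω → M) {x : Ω → Fin n → X} (y : Ω → Fin n → Y)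
    {z : Ω → Fin n → Z} (hD : ∀ ω, p ω ≠ 0 → 1 / (n : ℝ) * ∑ i, d (x ω i) (z ω i) ≤ D) :
    ∑ ω, singleLetter p m x y z ω * d ω.2.1 ω.2.2.2 ≤ D := by
  calc ∑ ω, singleLetter p m x y z ω * d ω.2.1 ω.2.2.2
      = ∑ ω, p ω * (1 / (n : ℝ) * ∑ i, d (x ω i) (z ω i)) := by
        rw [singleLetter, sum_law_mul, sum_timeShare_mul p
          (fun v : Fin n × Ω => d (x v.2 v.1) (z v.2 v.1)), sum_comm, mul_sum]
        refine sum_congr rfl fun ω _ => ?_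
        rw [← mul_sum, Fintype.card_fin, one_div, mul_left_comm]
    _ ≤ ∑ ω, p ω * D := by
        refine sum_le_sum fun ω _ => ?_
        rcases eq_or_ne (p ω) 0 with hω | hω
        · simp [hω]
        · exact mul_le_mul_of_nonneg_left (hD ω hω) (hp.1 ω)
    _ = D := by rw [← sum_mul, hp.2, one_mul]

section ChangeOfMeasure

variable {n : ℕ} [NeZero n] {p : (Fin n → X × Y) → ℝ} {m : (Fin n → X × Y) → M}
  {z : (Fin n → X × Y) → Fin n → Z}

theorem mul_entropy_source_sub_entropy_le (hP : P ∈ stdSimplex ℝ (X × Y))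
    (hp : p ∈ stdSimplex ℝ (Fin n → X × Y)) (hac : ∀ ω, iid (Fin n) P ω = 0 → p ω = 0) :
    n * entropy (timeShare (Fin n) p) (fun v => ((v.2 v.1).1, (v.2 v.1).2))
        - entropy p (fun ω => ((fun i => (ω i).1), fun i => (ω i).2))
      ≤ relEntropy p (iid (Fin n) P) := by
  have hle := card_mul_entropy_timeShare_sub_entropy_le hP hp hac
  rwa [Fintype.card_fin, entropy_congr p (f := fun ω => ω)
    (g := fun ω => ((fun i => (ω i).1), fun i => (ω i).2)) fun ω ω' => by
      simp [funext_iff, Prod.ext_iff, forall_and]] at hle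

theorem codingRate_singleLetter_le (hP : P ∈ stdSimplex ℝ (X × Y))
    (hp : p ∈ stdSimplex ℝ (Fin n → X × Y)) (hac : ∀ ω, iid (Fin n) P ω = 0 → p ω = 0)
    (hm : m.FactorsThrough fun ω i => (ω i).1)
    (hz : z.FactorsThrough fun ω => (m ω, fun i => (ω i).2)) :
    codingRate (singleLetter p m (fun ω i => (ω i).1) (fun ω i => (ω i).2) z)
      ≤ (Real.logb 2 (Fintype.card M) + relEntropy p (iid (Fin n) P)) / n := by
  rw [le_div_iff₀' (by exact_mod_cast NeZero.pos n)]
  exact (mul_codingRate_le hp hm hz).trans <|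
    add_le_add_right (mul_entropy_source_sub_entropy_le hP hp hac) _

theorem isNearlyFeasible_singleLetter (hP : P ∈ stdSimplex ℝ (X × Y))
    (hp : p ∈ stdSimplex ℝ (Fin n → X × Y)) (hac : ∀ ω, iid (Fin n) P ω = 0 → p ω = 0)
    (hm : m.FactorsThrough fun ω i => (ω i).1)
    (hz : z.FactorsThrough fun ω => (m ω, fun i => (ω i).2))
    (hD : ∀ ω, p ω ≠ 0 → 1 / (n : ℝ) * ∑ i, d (ω i).1 (z ω i) ≤ D) :
    IsNearlyFeasible P d D (relEntropy p (iid (Fin n) P) / n)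
      (singleLetter p m (fun ω i => (ω i).1) (fun ω i => (ω i).2) z) := by
  have hn : (0 : ℝ) < n := by exact_mod_cast NeZero.pos n
  set Q := singleLetter p m (fun ω i => (ω i).1) (fun ω i => (ω i).2) z
  have hQ : Q ∈ stdSimplex ℝ _ := singleLetter_mem_stdSimplex hp m _ _ z
  have hsource : law Q (fun ω => (ω.2.1, ω.2.2.1))
      = law (timeShare (Fin n) p) fun v => v.2 v.1 :=
    law_source_singleLetter p m _ _ z
  have hdefects : n * (encoderDefect Q + decoderDefect Q) ≤ relEntropy p (iid (Fin n) P) :=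
    (mul_encoderDefect_add_decoderDefect_le hp hm hz).trans
      (mul_entropy_source_sub_entropy_le hP hp hac)
  rw [← le_div_iff₀' hn] at hdefects
  have hencoder : 0 ≤ encoderDefect Q := condMutualInfo_nonneg hQ.1 _ _ _
  have hdecoder : 0 ≤ decoderDefect Q := condMutualInfo_nonneg hQ.1 _ _ _
  have hdivergence := card_mul_relEntropy_law_timeShare_le hP hp hac
  rw [Fintype.card_fin, ← le_div_iff₀' hn, ← hsource] at hdivergence
  exact {
    mem_stdSimplex := hQ
    support := fun xy hxy => hsource ▸ law_timeShare_eq_zero hac hxy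
    relEntropy_le := hdivergence
    encoderDefect_le := by linarith
    decoderDefect_le := by linarith
    distortion_le := sum_singleLetter_mul_le hp m _ hD }

end ChangeOfMeasure

theorem exists_isNearlyFeasible_of_excessProb_le {n : ℕ} [NeZero n]
    (hP : P ∈ stdSimplex ℝ (X × Y)) (φ : (Fin n → X) → M) (g : M → (Fin n → Y) → (Fin n → Z))
    {c : ℝ} (hc : c < 1) (hexcess : excessProb P d D φ g ≤ c) :
    ∃ Q : (Fin n × M × (Fin n → Option X) × (Fin n → Option Y)) × X × Y × Z → ℝ,
      IsNearlyFeasible P d D (-Real.logb 2 (1 - c) / n) Q ∧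
        codingRate Q ≤ (Real.logb 2 (Fintype.card M) - Real.logb 2 (1 - c)) / n := by
  have hiid := iid_mem_stdSimplex (ι := Fin n) hP
  set G : Set (Fin n → X × Y) := {ω | 1 / (n : ℝ) *
    ∑ i, d (ω i).1 (g (φ fun j => (ω j).1) (fun j => (ω j).2) i) ≤ D}
  have hG : 1 - c ≤ prob (iid (Fin n) P) G := by
    rw [prob_setOf_le_eq_one_sub_excessProb hP]
    linarith
  have hG_ne : prob (iid (Fin n) P) G ≠ 0 := (sub_pos.2 hc |>.trans_le hG).ne'
  have hp : condOn (iid (Fin n) P) G ∈ stdSimplex ℝ _ := condOn_mem_stdSimplex hiid.1 hG_ne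
  have hentropy : relEntropy (condOn (iid (Fin n) P) G) (iid (Fin n) P)
      ≤ -Real.logb 2 (1 - c) := by
    rw [relEntropy_condOn hiid hG_ne, neg_le_neg_iff]
    exact Real.logb_le_logb_of_le one_lt_two (sub_pos.2 hc) hG
  have hm : (fun ω : Fin n → X × Y => φ fun j => (ω j).1).FactorsThrough fun ω i => (ω i).1 :=
    fun _ _ => congrArg φ
  have hz : (fun ω : Fin n → X × Y => g (φ fun j => (ω j).1) fun j => (ω j).2).FactorsThrough
      fun ω => (φ fun j => (ω j).1, fun i => (ω i).2) :=
    fun _ _ => congrArg (Function.uncurry g)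
  have hD (ω : Fin n → X × Y) (hω : condOn (iid (Fin n) P) G ω ≠ 0) :
      1 / (n : ℝ) * ∑ i, d (ω i).1 (g (φ fun j => (ω j).1) (fun j => (ω j).2) i) ≤ D :=
    mem_of_condOn_ne_zero (G := G) hω
  refine ⟨_, (isNearlyFeasible_singleLetter hP hp (fun ω => condOn_eq_zero) hm hz hD).mono
    (by gcongr),
    (codingRate_singleLetter_le hP hp (fun ω => condOn_eq_zero) hm hz).trans ?_⟩
  rw [sub_eq_add_neg]
  gcongr

theorem exists_feasibleRate_le_of_achievable (hP : P ∈ stdSimplex ℝ (X × Y)) {ε R : ℝ} (hε : ε < 1)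
    (hR : 0 ≤ R) (h : Achievable P d D ε R) : ∃ r ∈ feasibleRates P d D, r ≤ R := by
  obtain ⟨φ, g, hlimsup⟩ := h
  obtain ⟨c, hεc, hc⟩ := exists_between hε
  have hbound (n : ℕ) : excessProb P d D (φ n) (g n) ≤ 1 := by
    have hprob := prob_nonneg (iid_mem_stdSimplex hP).1 {ω | 1 / (n : ℝ) *
      ∑ i, d (ω i).1 (g n (φ n fun j => (ω j).1) (fun j => (ω j).2) i) ≤ D}
    rw [prob_setOf_le_eq_one_sub_excessProb hP] at hprob
    linarith
  have hexcess : ∀ᶠ n in atTop, excessProb P d D (φ n) (g n) < c :=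
    eventually_lt_of_limsup_lt (hlimsup.trans_lt hεc) (isBoundedUnder_of ⟨1, hbound⟩)
  refine exists_feasibleRate_le_of_tendsto hP (l := atTop)
    (T := fun n => Fin n × (Fin ⌈(n : ℝ) * R⌉₊ → Bool) × (Fin n → Option X) × (Fin n → Option Y))
    (tendsto_const_div_atTop_nhds_zero_nat (1 - Real.logb 2 (1 - c))) ?_
  filter_upwards [hexcess, eventually_gt_atTop 0] with n hn hn_pos
  have : NeZero n := ⟨hn_pos.ne'⟩
  have hn_cast : (0 : ℝ) < n := by exact_mod_cast hn_pos
  obtain ⟨Q, hQ, hrate⟩ := exists_isNearlyFeasible_of_excessProb_le hP (φ n) (g n) hc hn.le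
  refine ⟨Q, hQ.mono (by gcongr; linarith), hrate.trans ?_⟩
  have hcard : Real.logb 2 (Fintype.card (Fin ⌈(n : ℝ) * R⌉₊ → Bool)) = ⌈(n : ℝ) * R⌉₊ := by
    simp [Real.logb_pow]
  have hceil : (⌈(n : ℝ) * R⌉₊ : ℝ) < n * R + 1 := Nat.ceil_lt_add_one (by positivity)
  rw [hcard, div_le_iff₀ hn_cast, add_mul, div_mul_cancel₀ _ hn_cast.ne']
  linarith

end Codes

end WynerZiv

theorem mainTheorem2_general {X Y Z : Type*} [Fintype X] [Fintype Y] [Fintype Z]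
    (P : X × Y → ℝ) (hP : P ∈ stdSimplex ℝ (X × Y)) (d : X → Z → ℝ) (D : ℝ) :
    ((WynerZiv.feasibleRates P d D).Nonempty →
      ∃ r : ℝ, IsLeast (WynerZiv.feasibleRates P d D) r ∧ WynerZiv.Rmin P d D = (r : EReal)) ∧
    ∀ ε R : ℝ, ε < 1 → 0 ≤ R → (R : EReal) < WynerZiv.Rmin P d D →
      ¬ WynerZiv.Achievable P d D ε R := by
  constructor
  · intro hne
    obtain ⟨r, hr⟩ := (WynerZiv.isCompact_feasibleRates hP d D).exists_isLeast hne
    exact ⟨r, hr, le_antisymm (iInf₂_le r hr.1)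
      (le_iInf₂ fun r' hr' => EReal.coe_le_coe_iff.2 (hr.2 hr'))⟩
  · intro ε R hε hR hlt hachievable
    obtain ⟨r, hr, hrR⟩ := WynerZiv.exists_feasibleRate_le_of_achievable hP hε hR hachievable
    exact hlt.not_ge ((iInf₂_le r hr).trans (EReal.coe_le_coe_iff.2 hrR))

theorem mainTheorem2 {X Y Z : Type*} [Fintype X] [Fintype Y] [Fintype Z]
    (P : X × Y → ℝ) (hP : P ∈ stdSimplex ℝ (X × Y))
    (d : X → Z → ℝ) (hd : ∀ x z, 0 ≤ d x z) (D : ℝ) (hD : 0 < D) :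
    ((WynerZiv.feasibleRates P d D).Nonempty →
      ∃ r : ℝ, IsLeast (WynerZiv.feasibleRates P d D) r ∧ WynerZiv.Rmin P d D = (r : EReal)) ∧
    ∀ ε R : ℝ, 0 ≤ ε → ε < 1 → 0 < R → (R : EReal) < WynerZiv.Rmin P d D →
      ¬ WynerZiv.Achievable P d D ε R :=
  (mainTheorem2_general P hP d D).imp_right fun hconverse ε R _ hε hR => hconverse ε R hε hR.le
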